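/- Let $\xi_1,\xi_2,\dots$ be a stochastic process on a probability space $(\Omega,P)$ with values in a measurable space $\Xi$, let $\mathcal F_t=\sigma(\xi_1,\dots,\xi_t)$ ($\mathcal F_0$ trivial), and let $\pi$ be a probability distribution on $\Xi$. Assume that $\pi$ and the laws of all $\xi_t$ are absolutely continuous with respect to a measure $\mu$ on $\Xi$. With $d_{\mathrm{TV}}(Q,Q')=\sup_A|Q(A)-Q'(A)|$, define the mixing coefficients $$\phi(k)=\sup\bigl\{\,2\,d_{\mathrm{TV}}\bigl(P(\xi_{t+k}\in\cdot\mid B),\pi\bigr)\;:\;t\ge 1,\ B\in\mathcal F_t,\ P(B)>0\bigr\},\qquad k\ge 1 .$$ Let $W$ be a compact convex subset of a real normed space with $\|w-v\|\le R$ for all $w,v\in W$, and let $F(w;x)$, $w\in W$, $x\in\Xi$, be a loss function, measurable in $x$, such that for $\mu$-almost every $x$ the function $F(\cdot\,;x)$ is convex and $G$-Lipschitz on $W$ ($G\ge 0$) with values in $[0,GR]$. Put $f(w)=\int F(w;x)\,d\pi(x)$. Assume that $f$ is $\lambda$-strongly convex on $W$ for some $\lambda>0$, i.e. $f(v)\ge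 f(w)+\langle g,v-w\rangle+\frac{\lambda}{2}\|w-v\|^2$ for all $w,v\in W$ and all $g\in\partial f(w)$ (the subdifferential of $f$ as a function on $W$), and let $w^*\in\arg\min_{w\in W}f(w)$. Let $n\ge 3$ and let an online algorithm produce points $w(1),\dots,w(n)\in W$ such that $w(t)$ is $\mathcal F_{t-1}$-measurable and, almost surely, $\|w(t)-w(t+1)\|\le\kappa(t)$ for $1\le t<n$, where $\kappa(1)\ge\kappa(2)\ge\dots\ge 0$ is a fixed sequence. Let $R_n$ be a (possibly random) bound on its regret: for every $v\in W$, almost surely, $\sum_{t=1}^n\bigl[F(w(t);\xi_t)-F(v;\xi_t)\bigr]\le R_n$. Let $\hat w_n=\frac1n\sum_{t=1}^n w(t)$. Theorem. For every $\delta$ with $0<\delta<1/e$, with probability at least $1-4\delta\log n$ the following holds for all integers $\tau\ge 1$ simultaneously: $$f(\hat w_n)-f(w^*)\le\frac{2}{n}R_n+\frac{2(\tau-1)G}{n}\Bigl(\sum_{t=1}^n\kappa(t)+2R\Bigr)+\frac{32G^2\tau}{\lambda n}\log\frac{\tau}{\delta}+\frac{12\tau RG}{n}\log\frac{\tau}{\delta}+2RG\,\phi(\tau).$$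 -/

import Mathlib

open MeasureTheory ProbabilityTheory

noncomputable section

namespace OnlineMixing

/-- Total variation distance `sup_A |P(A) - Q(A)|`, the supremum being over measurable sets. -/
def tvDist {S : Type*} [MeasurableSpace S] (P Q : Measure S) : ℝ :=
  sSup {x : ℝ | ∃ A : Set S, MeasurableSet A ∧ x = |P.real A - Q.real A|}

/-- The σ-field `ℱ_t = σ(ξ_1, …, ξ_t)`; samples are numbered from `1`, and `ℱ_0` is trivial. -/
@[reducible] def pastSigma {Ω Ξ : Type*} [mΞ : MeasurableSpace Ξ] (ξ : ℕ → Ω → Ξ) (t : ℕ) :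
    MeasurableSpace Ω :=
  ⨆ s ∈ Set.Icc 1 t, MeasurableSpace.comap (ξ s) mΞ

/-- The weak φ-mixing coefficient `φ(k) = sup_{t ≥ 1, B ∈ ℱ_t} 2 d_TV(P(ξ_{t+k} ∈ · | B), π)`,
over events `B` of positive probability. -/
def phiCoeff {Ω Ξ : Type*} [MeasurableSpace Ω] [MeasurableSpace Ξ] (P : Measure Ω)
    (ξ : ℕ → Ω → Ξ) (π : Measure Ξ) (k : ℕ) : ℝ :=
  sSup {x : ℝ | ∃ t : ℕ, 1 ≤ t ∧ ∃ B : Set Ω, MeasurableSet[pastSigma ξ t] B ∧ P B ≠ 0 ∧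
    x = 2 * tvDist ((ProbabilityTheory.cond P B).map (ξ (t + k))) π}

/-- The expected loss `f(w) = ∫ F(w; x) dπ(x)`. -/
def risk {E Ξ : Type*} [MeasurableSpace Ξ] (F : E → Ξ → ℝ) (π : Measure Ξ) (w : E) : ℝ :=
  ∫ x, F w x ∂π

/-- The subdifferential at `w` of a function `f` with domain `W`. -/
def subdifferentialOn {E : Type*} [NormedAddCommGroup E] [NormedSpace ℝ E]
    (W : Set E) (f : E → ℝ) (w : E) : Set (E →L[ℝ] ℝ) :=
  {g | ∀ v ∈ W, f w + g (v - w) ≤ f v}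

/-- `f` is `lam`-strongly convex over `W` with respect to the norm of `E`. -/
def IsStronglyConvexOver {E : Type*} [NormedAddCommGroup E] [NormedSpace ℝ E]
    (W : Set E) (lam : ℝ) (f : E → ℝ) : Prop :=
  ∀ w ∈ W, ∀ v ∈ W, ∀ g ∈ subdifferentialOn W f w,
    f w + g (v - w) + lam / 2 * ‖w - v‖ ^ 2 ≤ f v

/-- Boundedness assumption: `W` is compact with `‖w - v‖ ≤ R` on `W`, and for `μ`-almost every
sample the loss is convex and `G`-Lipschitz over `W`, with values in `[0, G R]`. -/
structure BoundedLoss {E Ξ : Type*} [NormedAddCommGroup E] [NormedSpace ℝ E]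
    [MeasurableSpace Ξ] (W : Set E) (F : E → Ξ → ℝ) (μ : Measure Ξ) (G R : ℝ) : Prop where
  compact : IsCompact W
  radius : ∀ w ∈ W, ∀ v ∈ W, ‖w - v‖ ≤ R
  convex : ∀ᵐ x ∂μ, ConvexOn ℝ W (fun w => F w x)
  lipschitz : ∀ᵐ x ∂μ, ∀ w ∈ W, ∀ v ∈ W, |F w x - F v x| ≤ G * ‖w - v‖
  bounded : ∀ᵐ x ∂μ, ∀ w ∈ W, F w x ∈ Set.Icc 0 (G * R)

/-- The averaged predictor `(1/n) ∑_{t=1}^n w(t)`. -/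
def avgPredictor {Ω E : Type*} [NormedAddCommGroup E] [NormedSpace ℝ E]
    (w : ℕ → Ω → E) (n : ℕ) (ω : Ω) : E :=
  (n : ℝ)⁻¹ • ∑ t ∈ Finset.Icc 1 n, w t ω

/-- With `P`-probability at least `p`, the property `Q` holds. (No measurability of
`{ω | Q ω}` is presupposed: it contains an event of probability at least `p`.) -/
def HoldsWithProbAtLeast {Ω : Type*} [MeasurableSpace Ω] (P : Measure Ω) (p : ℝ)
    (Q : Ω → Prop) : Prop :=
  ∃ A : Set Ω, MeasurableSet A ∧ (∀ ω ∈ A, Q ω) ∧ p ≤ P.real A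

end OnlineMixing

end

/-!
The cumulative excess risk is compared with the regret through an exponential supermartingale with
one fixed parameter.

Fix the lag `τ`, write `H(v; x) = F(v; x) - F(w*; x)` and `m(v) = ∫ H(v; x) dπ(x) = f(v) - f(w*)`.
The iterate `v = w(r + 1)` depends only on `ξ_1, …, ξ_r`, so it is tested on the sample `ξ_{r+τ}`,
whose law given the past is within `φ(τ) / 2` of `π` in total variation. As `|H| ≤ G R`, the
conditional mean of `H(v; ξ_{r+τ})` is at least `m(v) - G R φ(τ)`. No regular conditional
distribution is needed for this: the inequality is integrated over past events, first for constant
and then for random `v` (`setIntegral_parametrized_nonneg`), and afterwards against past weights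
(`integral_mul_nonneg_of_forall_setIntegral_nonneg`).

Strong convexity at the minimizer gives `H(v; x)² ≤ G² ‖v - w*‖² ≤ (2 G² / λ) m(v)`. With
`C = 4 G² / λ + G R` and `s = 1 / C`, the bound `exp (-s H) ≤ 1 - s H + s² H²` therefore costs only
half of the mean, and `exp (s ∑ (m / 2 - H - G R φ(τ)))`, summed over one residue class modulo `τ`,
has expectation at most `1` (`integrable_and_integral_exp_sum_deviation_le_one`): within a class
the sample tested at one index is past information at the next.

By Markov's inequality each class exceeds `2 C log (τ / δ)` with probability at most `(δ / τ)²`.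
The sum over the `τ` classes and over all `τ ≤ n` is `δ²` times a harmonic number, which is below
`4 δ log n`; so the bound holds for all `τ` at once. For `τ > n` it holds trivially.

Outside the exceptional event the classes are added up. Replacing `w(r + 1)` by `w(r + τ)` in front
of `ξ_{r+τ}` costs `τ - 1` stability terms, the `τ` unmatched summands at the ends are at most
`G R` each, and Jensen's inequality passes to the averaged iterate.
-/

namespace OnlineMixing

open Filter Topology

/-! ### Total variation and the mixing coefficient -/

theorem pastSigma_mono {Ω Ξ : Type*} [MeasurableSpace Ξ] (ξ : ℕ → Ω → Ξ) {s t : ℕ} (hst : s ≤ t) :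
    pastSigma ξ s ≤ pastSigma ξ t :=
  biSup_mono fun _ hr => ⟨hr.1, hr.2.trans hst⟩

theorem measurable_pastSigma {Ω Ξ : Type*} [mΞ : MeasurableSpace Ξ] (ξ : ℕ → Ω → Ξ) {s t : ℕ}
    (hs : 1 ≤ s) (hst : s ≤ t) :
    Measurable[pastSigma ξ t] (ξ s) :=
  Measurable.mono (comap_measurable (ξ s))
    (le_biSup (fun s => MeasurableSpace.comap (ξ s) mΞ) (show s ∈ Set.Icc 1 t from ⟨hs, hst⟩))
    le_rfl

section

variable {Ω Ξ V : Type*} [mΩ : MeasurableSpace Ω] [mΞ : MeasurableSpace Ξ]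

theorem bddAbove_tvDist_set {S : Type*} [MeasurableSpace S] (P Q : Measure S)
    [IsProbabilityMeasure P] [IsProbabilityMeasure Q] :
    BddAbove {x : ℝ | ∃ A : Set S, MeasurableSet A ∧ x = |P.real A - Q.real A|} := by
  refine ⟨1, ?_⟩
  rintro x ⟨A, -, rfl⟩
  rw [abs_le]
  constructor <;>
    linarith [measureReal_le_one (μ := P) (s := A), measureReal_le_one (μ := Q) (s := A),
      measureReal_nonneg (μ := P) (s := A), measureReal_nonneg (μ := Q) (s := A)]

theorem abs_sub_le_tvDist {S : Type*} [MeasurableSpace S] (P Q : Measure S)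
    [IsProbabilityMeasure P] [IsProbabilityMeasure Q] {A : Set S} (hA : MeasurableSet A) :
    |P.real A - Q.real A| ≤ tvDist P Q :=
  le_csSup (bddAbove_tvDist_set P Q) ⟨A, hA, rfl⟩

theorem tvDist_nonneg {S : Type*} [MeasurableSpace S] (P Q : Measure S) : 0 ≤ tvDist P Q :=
  Real.sSup_nonneg (by rintro x ⟨A, -, rfl⟩; exact abs_nonneg _)

theorem tvDist_le_one {S : Type*} [MeasurableSpace S] (P Q : Measure S)
    [IsProbabilityMeasure P] [IsProbabilityMeasure Q] : tvDist P Q ≤ 1 := by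
  refine csSup_le ⟨_, ∅, MeasurableSet.empty, rfl⟩ ?_
  rintro x ⟨A, -, rfl⟩
  rw [abs_le]
  constructor <;>
    linarith [measureReal_le_one (μ := P) (s := A), measureReal_le_one (μ := Q) (s := A),
      measureReal_nonneg (μ := P) (s := A), measureReal_nonneg (μ := Q) (s := A)]

theorem integrable_of_forall_abs_le {S : Type*} [MeasurableSpace S] {P : Measure S}
    [IsFiniteMeasure P] {h : S → ℝ} (hh : Measurable h) {b : ℝ} (hb : ∀ x, |h x| ≤ b) :
    Integrable h P :=
  Integrable.of_bound hh.aestronglyMeasurable b (Eventually.of_forall hb)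

/-- Expectations of a function with values in `[-b, b]` under two distributions differ by at most
`2b` times their total variation distance, by the layer-cake formula. -/
theorem integral_sub_integral_le_tvDist {S : Type*} [MeasurableSpace S] (P Q : Measure S)
    [IsProbabilityMeasure P] [IsProbabilityMeasure Q] {h : S → ℝ} (hh : Measurable h) {b : ℝ}
    (hb : ∀ x, |h x| ≤ b) : ∫ x, h x ∂Q - ∫ x, h x ∂P ≤ 2 * b * tvDist P Q := by
  have hb0 : 0 ≤ b := by
    obtain ⟨x⟩ := nonempty_of_isProbabilityMeasure P
    exact (abs_nonneg _).trans (hb x)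
  have key : ∀ (M : Measure S) [IsProbabilityMeasure M],
      ∫ x, h x ∂M + b = ∫ t in Set.Ioc 0 (2 * b), M.real {a | t ≤ h a + b} := by
    intro M _
    have hi := integrable_of_forall_abs_le (P := M) hh hb
    rw [← Integrable.integral_eq_integral_Ioc_meas_le (f := fun x => h x + b)
      (hi.add (integrable_const b))
      (Eventually.of_forall fun x => by have := abs_le.1 (hb x); simp; linarith)
      (Eventually.of_forall fun x => by have := abs_le.1 (hb x); simp; linarith)]
    rw [integral_add hi (integrable_const b)]
    simp
  have hint : ∀ (M : Measure S) [IsProbabilityMeasure M],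
      IntegrableOn (fun t : ℝ => M.real {a | t ≤ h a + b}) (Set.Ioc 0 (2 * b)) := by
    intro M _
    have hanti : Antitone fun t : ℝ => M.real {a | t ≤ h a + b} := fun s t hst =>
      measureReal_mono fun a (ha : t ≤ h a + b) => hst.trans ha
    exact Integrable.of_bound hanti.measurable.aestronglyMeasurable 1
      (Eventually.of_forall fun t => by
        rw [Real.norm_of_nonneg measureReal_nonneg]; exact measureReal_le_one)
  have h1 : ∫ x, h x ∂Q - ∫ x, h x ∂P
      = ∫ t in Set.Ioc 0 (2 * b), (Q.real {a | t ≤ h a + b} - P.real {a | t ≤ h a + b}) := by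
    rw [integral_sub (hint Q) (hint P), ← key Q, ← key P]; ring
  rw [h1]
  calc _ ≤ ∫ _ in Set.Ioc 0 (2 * b), tvDist P Q := by
        refine setIntegral_mono ((hint Q).sub (hint P)) (integrable_const _) fun t => ?_
        have := abs_sub_le_tvDist P Q (A := {a | t ≤ h a + b})
          (measurableSet_le measurable_const (hh.add_const b))
        rw [abs_sub_comm] at this
        exact (le_abs_self _).trans this
    _ = 2 * b * tvDist P Q := by
        simp [hb0]

theorem pastSigma_le {ξ : ℕ → Ω → Ξ} (hξ : ∀ t, 1 ≤ t → Measurable (ξ t)) (t : ℕ) :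
    pastSigma ξ t ≤ mΩ :=
  iSup₂_le fun s hs => (hξ s hs.1).comap_le

theorem phiCoeff_nonneg (P : Measure Ω) (ξ : ℕ → Ω → Ξ) (π : Measure Ξ) (k : ℕ) :
    0 ≤ phiCoeff P ξ π k := by
  refine Real.sSup_nonneg ?_
  rintro x ⟨t, -, B, -, -, rfl⟩
  exact mul_nonneg zero_le_two (tvDist_nonneg _ _)

section Mixing

variable {P : Measure Ω} [IsProbabilityMeasure P] {ξ : ℕ → Ω → Ξ}
  {π : Measure Ξ} [IsProbabilityMeasure π]

theorem two_mul_tvDist_cond_le_phiCoeff (hξ : ∀ t, 1 ≤ t → Measurable (ξ t)) {t : ℕ} (ht : 1 ≤ t)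
    (k : ℕ) {B : Set Ω} (hB : MeasurableSet[pastSigma ξ t] B) (hPB : P B ≠ 0) :
    2 * tvDist ((ProbabilityTheory.cond P B).map (ξ (t + k))) π ≤ phiCoeff P ξ π k := by
  refine le_csSup ⟨2, ?_⟩ ⟨t, ht, B, hB, hPB, rfl⟩
  rintro x ⟨s, hs, A, -, hA, rfl⟩
  have := ProbabilityTheory.cond_isProbabilityMeasure (μ := P) hA
  have := Measure.isProbabilityMeasure_map (μ := ProbabilityTheory.cond P A)
    (hξ (s + k) (by omega)).aemeasurable
  linarith [tvDist_le_one ((ProbabilityTheory.cond P A).map (ξ (s + k))) π]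

/-- On every past event the integral of a bounded function of a sample `k` steps ahead is close to
its value for a sample from `π`. -/
theorem setIntegral_comp_ge (hξ : ∀ t, 1 ≤ t → Measurable (ξ t)) {t : ℕ} (ht : 1 ≤ t)
    (k : ℕ) {B : Set Ω} (hB : MeasurableSet[pastSigma ξ t] B)
    {h : Ξ → ℝ} (hh : Measurable h) {b : ℝ} (hb : ∀ x, |h x| ≤ b) :
    P.real B * (∫ x, h x ∂π - b * phiCoeff P ξ π k) ≤ ∫ ω in B, h (ξ (t + k) ω) ∂P := by
  have hξm := hξ (t + k) (by omega)
  rcases eq_or_ne (P B) 0 with h0 | h0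
  · rw [Measure.restrict_eq_zero.2 h0]; simp [Measure.real, h0]
  have hc := ProbabilityTheory.cond_isProbabilityMeasure (μ := P) h0
  have hm := Measure.isProbabilityMeasure_map (μ := ProbabilityTheory.cond P B) hξm.aemeasurable
  have hpos : 0 < P.real B := ENNReal.toReal_pos h0 (measure_ne_top _ _)
  have hb0 : 0 ≤ b := by
    obtain ⟨x⟩ := nonempty_of_isProbabilityMeasure π
    exact (abs_nonneg _).trans (hb x)
  have h1 := integral_sub_integral_le_tvDist ((ProbabilityTheory.cond P B).map (ξ (t + k))) π hh hb
  rw [integral_map hξm.aemeasurable hh.aestronglyMeasurable, ProbabilityTheory.cond,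
    integral_smul_measure, ENNReal.toReal_inv, smul_eq_mul] at h1
  have h2 := mul_le_mul_of_nonneg_left (two_mul_tvDist_cond_le_phiCoeff (π := π) hξ ht k hB h0) hb0
  have h3 : ∫ x, h x ∂π - b * phiCoeff P ξ π k
      ≤ (P.real B)⁻¹ * ∫ ω in B, h (ξ (t + k) ω) ∂P := by
    rw [ProbabilityTheory.cond] at h2
    unfold Measure.real
    linarith
  calc _ ≤ P.real B * ((P.real B)⁻¹ * ∫ ω in B, h (ξ (t + k) ω) ∂P) :=
        mul_le_mul_of_nonneg_left h3 hpos.le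
    _ = _ := by field_simp

variable [TopologicalSpace V] [TopologicalSpace.MetrizableSpace V] [SecondCountableTopology V]
  [MeasurableSpace V] [BorelSpace V]

/-- The fixed test function of `setIntegral_comp_ge` may be replaced by a member, selected by the
past, of a family depending continuously on a parameter: for a selection with finitely many
values the event is split according to them, and the general one is a pointwise limit of these. -/
theorem setIntegral_parametrized_nonneg (hξ : ∀ t, 1 ≤ t → Measurable (ξ t)) {t : ℕ} (ht : 1 ≤ t)
    (k : ℕ) {H : V → Ξ → ℝ} (hHm : ∀ v, Measurable (H v)) (hHc : ∀ x, Continuous fun v => H v x)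
    {b : ℝ} (hb : ∀ v x, |H v x| ≤ b) {u : Ω → V} (hu : Measurable[pastSigma ξ t] u)
    {B : Set Ω} (hB : MeasurableSet[pastSigma ξ t] B) :
    0 ≤ ∫ ω in B, (H (u ω) (ξ (t + k) ω) - ∫ x, H (u ω) x ∂π + b * phiCoeff P ξ π k) ∂P := by
  have hξm := hξ (t + k) (by omega)
  have hle := pastSigma_le hξ t
  have hmc : Continuous fun v => ∫ x, H v x ∂π :=
    continuous_of_dominated (fun v => (hHm v).aestronglyMeasurable)
      (fun v => Eventually.of_forall (hb v)) (integrable_const b) (Eventually.of_forall hHc)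
  have hmb : ∀ v, |∫ x, H v x ∂π| ≤ b := fun v => by
    simpa using norm_integral_le_of_norm_le_const (μ := π) (f := H v) (Eventually.of_forall (hb v))
  set c := b * phiCoeff P ξ π k with hc
  have hjoint : Measurable (Function.uncurry H) :=
    measurable_uncurry_of_continuous_of_measurable hHc hHm
  -- the integrand for an arbitrary selection
  let g : (Ω → V) → Ω → ℝ := fun u ω => H (u ω) (ξ (t + k) ω) - ∫ x, H (u ω) x ∂π + c
  have hgm : ∀ u : Ω → V, Measurable u → Measurable (g u) := fun u hu =>
    ((hjoint.comp (hu.prodMk hξm)).sub (hmc.measurable.comp hu)).add_const c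
  have hgb : ∀ u ω, |g u ω| ≤ b + b + |c| := fun u ω =>
    (abs_add_le _ _).trans (add_le_add ((abs_sub _ _).trans (add_le_add (hb _ _) (hmb _))) le_rfl)
  let ap : ℕ → SimpleFunc V V := (stronglyMeasurable_id (α := V)).approx
  have hap : ∀ v, Tendsto (fun N => ap N v) atTop (𝓝 v) :=
    (stronglyMeasurable_id (α := V)).tendsto_approx
  have hum : Measurable u := hu.mono hle le_rfl
  have hlim : Tendsto (fun N => ∫ ω in B, g (fun ω => ap N (u ω)) ω ∂P) atTop
      (𝓝 (∫ ω in B, g u ω ∂P)) := by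
    refine tendsto_integral_of_dominated_convergence (fun _ => b + b + |c|)
      (fun N => (hgm _ ((ap N).measurable.comp hum)).aestronglyMeasurable) (integrable_const _)
      (fun N => Eventually.of_forall (hgb _)) (Eventually.of_forall fun ω => ?_)
    exact ((((hHc _).tendsto _).comp (hap (u ω))).sub
      ((hmc.tendsto _).comp (hap (u ω)))).add_const c
  refine ge_of_tendsto' hlim fun N => ?_
  have hcell : ∀ v, MeasurableSet[pastSigma ξ t] (B ∩ u ⁻¹' (ap N ⁻¹' {v})) := fun v =>
    hB.inter (hu ((ap N).measurableSet_fiber v))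
  have hBU : B = ⋃ v ∈ (ap N).range, B ∩ u ⁻¹' (ap N ⁻¹' {v}) := by
    ext ω; simp
  have hgi : Integrable (g fun ω => ap N (u ω)) P :=
    integrable_of_forall_abs_le (hgm _ ((ap N).measurable.comp hum)) (hgb _)
  rw [hBU, integral_biUnion_finset _ (fun v _ => hle _ (hcell v)) ?_
    (fun v _ => hgi.integrableOn)]
  · refine Finset.sum_nonneg fun v _ => ?_
    have hcong : ∫ ω in B ∩ u ⁻¹' (ap N ⁻¹' {v}), g (fun ω => ap N (u ω)) ω ∂P
        = ∫ ω in B ∩ u ⁻¹' (ap N ⁻¹' {v}), (H v (ξ (t + k) ω) + (c - ∫ x, H v x ∂π)) ∂P := by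
      refine setIntegral_congr_fun (hle _ (hcell v)) fun ω hω => ?_
      have : ap N (u ω) = v := hω.2
      simp only [g, this]; ring
    have hHi : IntegrableOn (fun ω => H v (ξ (t + k) ω)) (B ∩ u ⁻¹' (ap N ⁻¹' {v})) P :=
      (integrable_of_forall_abs_le ((hHm v).comp hξm) fun ω => hb _ _).integrableOn
    rw [hcong, integral_add hHi (integrable_const _)]
    have := setIntegral_comp_ge (P := P) (π := π) hξ ht k (hcell v) (hHm v) (hb v)
    simp only [integral_const, smul_eq_mul, MeasurableSet.univ, measureReal_restrict_apply,
      Set.univ_inter]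
    linarith
  · intro v _ v' _ hne
    refine Set.disjoint_left.2 fun ω h1 h2 => hne ?_
    exact (show ap N (u ω) = v from h1.2).symm.trans h2.2

theorem integral_mul_nonneg_of_forall_setIntegral_nonneg {m : MeasurableSpace Ω} (hm : m ≤ mΩ)
    {g Z : Ω → ℝ} (hg : Integrable g P)
    (hpos : ∀ B, MeasurableSet[m] B → 0 ≤ ∫ ω in B, g ω ∂P)
    (hZ : StronglyMeasurable[m] Z) (hZ0 : ∀ ω, 0 ≤ Z ω) (hZg : Integrable (Z * g) P) :
    0 ≤ ∫ ω, Z ω * g ω ∂P := by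
  have h1 : 0 ≤ᵐ[P] P[g|m] := by
    refine ae_le_of_ae_le_trim (hm := hm) ?_
    refine ae_nonneg_of_forall_setIntegral_nonneg
      (integrable_condExp.trim hm stronglyMeasurable_condExp) fun s hs _ => ?_
    rw [← setIntegral_trim hm stronglyMeasurable_condExp hs, setIntegral_condExp hm hg hs]
    exact hpos s hs
  have h2 := condExp_mul_of_stronglyMeasurable_left hZ hZg hg
  calc (0 : ℝ) ≤ ∫ ω, (Z * P[g|m]) ω ∂P := by
        refine integral_nonneg_of_ae ?_
        filter_upwards [h1] with ω hω using mul_nonneg (hZ0 ω) hω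
    _ = ∫ ω, (P[Z * g|m]) ω ∂P := (integral_congr_ae h2).symm
    _ = _ := integral_condExp hm

end Mixing

end

/-! ### The exponential supermartingale along a residue class -/

section Supermartingale

/-- The compensated deviation `m(u)/2 - H(u; ξ_{r+k}) - b φ(k)`, with `m(v) = ∫ H(v; x) dπ(x)`,
of a parameter `u` known at time `r` and tested on the sample `k` steps later. -/
noncomputable def deviation {Ω Ξ V : Type*} [MeasurableSpace Ω] [MeasurableSpace Ξ] (P : Measure Ω)
    (ξ : ℕ → Ω → Ξ) (π : Measure Ξ) (H : V → Ξ → ℝ) (b : ℝ) (k : ℕ) (u : ℕ → Ω → V) (r : ℕ)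
    (ω : Ω) : ℝ :=
  (∫ x, H (u r ω) x ∂π) / 2 - H (u r ω) (ξ (r + k) ω) - b * phiCoeff P ξ π k

variable {Ω Ξ V : Type*} [mΩ : MeasurableSpace Ω] [mΞ : MeasurableSpace Ξ]
  {P : Measure Ω} {ξ : ℕ → Ω → Ξ} {π : Measure Ξ} [IsProbabilityMeasure π]
  {H : V → Ξ → ℝ} {b : ℝ} {k : ℕ} {u : ℕ → Ω → V}

theorem abs_integral_le_of_forall_abs_le (hb : ∀ v x, |H v x| ≤ b) (v : V) :
    |∫ x, H v x ∂π| ≤ b := by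
  simpa using norm_integral_le_of_norm_le_const (μ := π) (f := H v) (Eventually.of_forall (hb v))

theorem abs_deviation_le (hb : ∀ v x, |H v x| ≤ b) (r : ℕ) (ω : Ω) :
    |deviation P ξ π H b k u r ω| ≤ b / 2 + b + |b * phiCoeff P ξ π k| := by
  have h1 := abs_integral_le_of_forall_abs_le (π := π) hb (u r ω)
  refine (abs_sub _ _).trans (add_le_add ((abs_sub _ _).trans (add_le_add ?_ (hb _ _))) le_rfl)
  rw [abs_div, abs_two]
  linarith

variable [TopologicalSpace V] [TopologicalSpace.MetrizableSpace V]

theorem continuous_integral_parameter (hHm : ∀ v, Measurable (H v))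
    (hHc : ∀ x, Continuous fun v => H v x) (hb : ∀ v x, |H v x| ≤ b) :
    Continuous fun v => ∫ x, H v x ∂π :=
  continuous_of_dominated (fun v => (hHm v).aestronglyMeasurable)
    (fun v => Eventually.of_forall (hb v)) (integrable_const b) (Eventually.of_forall hHc)

variable [SecondCountableTopology V]
  [MeasurableSpace V] [BorelSpace V]

theorem measurable_deviation (hHm : ∀ v, Measurable (H v))
    (hHc : ∀ x, Continuous fun v => H v x) (hb : ∀ v x, |H v x| ≤ b) {r : ℕ}
    (hr : 1 ≤ r) (hu : Measurable[pastSigma ξ r] (u r)) :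
    Measurable[pastSigma ξ (r + k)] (deviation P ξ π H b k u r) := by
  have hmc := continuous_integral_parameter (π := π) hHm hHc hb
  have hjoint : Measurable (Function.uncurry H) :=
    measurable_uncurry_of_continuous_of_measurable hHc hHm
  have hu' : Measurable[pastSigma ξ (r + k)] (u r) :=
    hu.mono (pastSigma_mono ξ (by omega)) le_rfl
  have hξm : Measurable[pastSigma ξ (r + k)] (ξ (r + k)) :=
    measurable_pastSigma ξ (by omega) le_rfl
  exact (((hmc.measurable.comp hu').div_const 2).sub
    (hjoint.comp (hu'.prodMk hξm))).sub_const _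

variable [IsProbabilityMeasure P]

/-- One step of the supermartingale. The bound `exp (-x) ≤ 1 - x + x²` makes the second moment of
`H` appear, and half of the mean `m` pays for it; the other half is what `deviation` keeps. -/
theorem integral_mul_exp_deviation_le (hξ : ∀ t, 1 ≤ t → Measurable (ξ t))
    (hHm : ∀ v, Measurable (H v)) (hHc : ∀ x, Continuous fun v => H v x)
    (hb : ∀ v x, |H v x| ≤ b) {s : ℝ} (hs : 0 ≤ s) (hsb : s * b ≤ 1)
    (hsq : ∀ v x, s * H v x ^ 2 ≤ (∫ y, H v y ∂π) / 2) {r : ℕ} (hr : 1 ≤ r)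
    (hu : Measurable[pastSigma ξ r] (u r)) {Z : Ω → ℝ} (hZ : Measurable[pastSigma ξ r] Z)
    (hZ0 : ∀ ω, 0 ≤ Z ω) {M : ℝ} (hZM : ∀ ω, Z ω ≤ M) :
    ∫ ω, Z ω * Real.exp (s * deviation P ξ π H b k u r ω) ∂P ≤ ∫ ω, Z ω ∂P := by
  have hle := pastSigma_le hξ r
  have hle' := pastSigma_le hξ (r + k)
  have hmc := continuous_integral_parameter (π := π) hHm hHc hb
  have hξm := hξ (r + k) (by omega)
  have hum : Measurable (u r) := hu.mono hle le_rfl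
  have hjoint : Measurable (Function.uncurry H) :=
    measurable_uncurry_of_continuous_of_measurable hHc hHm
  set c := b * phiCoeff P ξ π k with hc
  set m : V → ℝ := fun v => ∫ x, H v x ∂π with hm
  have hmb : ∀ v, |m v| ≤ b := abs_integral_le_of_forall_abs_le hb
  let g : Ω → ℝ := fun ω => H (u r ω) (ξ (r + k) ω) - m (u r ω) + c
  let Y : Ω → ℝ := fun ω => Z ω * Real.exp (s * (m (u r ω) / 2 - c))
  have hgm : Measurable g :=
    ((hjoint.comp (hum.prodMk hξm)).sub (hmc.measurable.comp hum)).add_const c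
  have hgb : ∀ ω, |g ω| ≤ b + b + |c| := fun ω =>
    (abs_add_le _ _).trans (add_le_add ((abs_sub _ _).trans (add_le_add (hb _ _) (hmb _))) le_rfl)
  have hYm : Measurable[pastSigma ξ r] Y :=
    hZ.mul (((((hmc.measurable.comp hu).div_const 2).sub_const c).const_mul s).exp)
  have hY0 : ∀ ω, 0 ≤ Y ω := fun ω => mul_nonneg (hZ0 ω) (Real.exp_nonneg _)
  have hYb : ∀ ω, |Y ω| ≤ M * Real.exp (s * (b / 2 + |c|)) := fun ω => by
    rw [abs_of_nonneg (hY0 ω)]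
    refine mul_le_mul (hZM ω) (Real.exp_le_exp.2 (mul_le_mul_of_nonneg_left ?_ hs))
      (Real.exp_nonneg _) ((hZ0 ω).trans (hZM ω))
    have := (abs_le.1 (hmb (u r ω))).2
    linarith [neg_abs_le c]
  have hYg : Integrable (Y * g) P :=
    integrable_of_forall_abs_le ((hYm.mono hle le_rfl).mul hgm)
      (b := M * Real.exp (s * (b / 2 + |c|)) * (b + b + |c|)) fun ω => by
        rw [Pi.mul_apply, abs_mul]
        exact mul_le_mul (hYb ω) (hgb ω) (abs_nonneg _) ((abs_nonneg _).trans (hYb ω))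
  have hZi : Integrable Z P := integrable_of_forall_abs_le (hZ.mono hle le_rfl) (b := M)
    fun ω => by rw [abs_of_nonneg (hZ0 ω)]; exact hZM ω
  have hpos : 0 ≤ ∫ ω, Y ω * g ω ∂P :=
    integral_mul_nonneg_of_forall_setIntegral_nonneg hle (integrable_of_forall_abs_le hgm hgb)
      (fun B hB => setIntegral_parametrized_nonneg hξ hr k hHm hHc hb hu hB)
      hYm.stronglyMeasurable hY0 hYg
  have hpt : ∀ ω, Z ω * Real.exp (s * deviation P ξ π H b k u r ω) ≤ Z ω - s * (Y ω * g ω) := by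
    intro ω
    set h := H (u r ω) (ξ (r + k) ω) with hh
    set y := s * (m (u r ω) / 2 - c) with hy
    have hsh : |-(s * h)| ≤ 1 := by
      rw [abs_neg, abs_mul, abs_of_nonneg hs]
      exact (mul_le_mul_of_nonneg_left (hb _ _) hs).trans hsb
    have h1 := (abs_le.1 (Real.abs_exp_sub_one_sub_id_le hsh)).2
    have h2 : s * (s * h ^ 2) ≤ s * (m (u r ω) / 2) := mul_le_mul_of_nonneg_left (hsq _ _) hs
    have h3 := Real.add_one_le_exp (-y)
    have h4 : Real.exp (-(s * h)) ≤ Real.exp (-y) - s * g ω := by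
      simp only [g, ← hh]; simp only [hy] at h3 ⊢; nlinarith
    have h5 : s * deviation P ξ π H b k u r ω = y + -(s * h) := by
      simp only [deviation, hy, hh, hm, hc]; ring
    rw [h5, Real.exp_add, ← mul_assoc]
    calc _ ≤ Z ω * Real.exp y * (Real.exp (-y) - s * g ω) :=
          mul_le_mul_of_nonneg_left h4 (hY0 ω)
      _ = Z ω * (Real.exp y * Real.exp (-y)) - s * (Y ω * g ω) := by simp only [Y, ← hy]; ring
      _ = _ := by rw [← Real.exp_add]; simp
  have hDm : Measurable (deviation P ξ π H b k u r) :=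
    (measurable_deviation hHm hHc hb hr hu).mono hle' le_rfl
  have hexp : Integrable (fun ω => Z ω * Real.exp (s * deviation P ξ π H b k u r ω)) P := by
    refine integrable_of_forall_abs_le ((hZ.mono hle le_rfl).mul (hDm.const_mul s).exp)
      (b := M * Real.exp (s * (b / 2 + b + |c|))) fun ω => ?_
    rw [abs_of_nonneg (mul_nonneg (hZ0 ω) (Real.exp_nonneg _))]
    exact mul_le_mul (hZM ω) (Real.exp_le_exp.2 (mul_le_mul_of_nonneg_left
      ((le_abs_self _).trans (abs_deviation_le hb r ω)) hs)) (Real.exp_nonneg _)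
      ((hZ0 ω).trans (hZM ω))
  calc _ ≤ ∫ ω, (Z ω - s * (Y ω * g ω)) ∂P :=
        integral_mono hexp (hZi.sub (hYg.const_mul s)) hpt
    _ = ∫ ω, Z ω ∂P - s * ∫ ω, Y ω * g ω ∂P := by
        rw [← integral_const_mul]
        exact integral_sub hZi (hYg.const_mul s)
    _ ≤ _ := by linarith [mul_nonneg hs hpos]

/-- Consecutive indices of a residue class modulo `k` are `k` apart, so the sample tested at one
index is already past information at the next. -/
theorem integrable_and_integral_exp_sum_deviation_le_one
    (hξ : ∀ t, 1 ≤ t → Measurable (ξ t))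
    (hHm : ∀ v, Measurable (H v)) (hHc : ∀ x, Continuous fun v => H v x)
    (hb : ∀ v x, |H v x| ≤ b) {s : ℝ} (hs : 0 ≤ s) (hsb : s * b ≤ 1)
    (hsq : ∀ v x, s * H v x ^ 2 ≤ (∫ y, H v y ∂π) / 2)
    (hu : ∀ r, 1 ≤ r → Measurable[pastSigma ξ r] (u r)) (i N : ℕ) :
    Integrable (fun ω => Real.exp (s * ∑ r ∈ Finset.Icc 1 N with r % k = i,
        deviation P ξ π H b k u r ω)) P ∧
      ∫ ω, Real.exp (s * ∑ r ∈ Finset.Icc 1 N with r % k = i,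
        deviation P ξ π H b k u r ω) ∂P ≤ 1 := by
  set K := b / 2 + b + |b * phiCoeff P ξ π k| with hK
  have hbd : ∀ (S : Finset ℕ) (ω : Ω),
      Real.exp (s * ∑ r ∈ S, deviation P ξ π H b k u r ω) ≤ Real.exp (s * (S.card • K)) :=
    fun S ω => Real.exp_le_exp.2 (mul_le_mul_of_nonneg_left (Finset.sum_le_card_nsmul _ _ _
      fun r _ => (le_abs_self _).trans (abs_deviation_le hb r ω)) hs)
  have hmeas : ∀ (T : ℕ) (S : Finset ℕ), (∀ r ∈ S, 1 ≤ r ∧ r + k ≤ T) →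
      Measurable[pastSigma ξ T]
        fun ω => Real.exp (s * ∑ r ∈ S, deviation P ξ π H b k u r ω) := by
    intro T S hS
    refine ((Finset.measurable_fun_sum _ fun r hr => ?_).const_mul s).exp
    exact (measurable_deviation hHm hHc hb (hS r hr).1 (hu r (hS r hr).1)).mono
      (pastSigma_mono ξ (hS r hr).2) le_rfl
  refine ⟨integrable_of_forall_abs_le (b := _) ((hmeas (N + k) _ fun r hr => ?_).mono
    (pastSigma_le hξ _) le_rfl) fun ω => (abs_of_pos (Real.exp_pos _)).trans_le (hbd _ ω), ?_⟩
  · have := Finset.mem_Icc.1 (Finset.mem_filter.1 hr).1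
    omega
  induction N with
  | zero => simp
  | succ N ih =>
    rw [← Finset.insert_Icc_right_eq_Icc_add_one (by omega), Finset.filter_insert]
    split_ifs with hi
    · have hnot : N + 1 ∉ (Finset.Icc 1 N).filter fun r => r % k = i := by simp
      simp only [Finset.sum_insert hnot, mul_add, Real.exp_add]
      refine le_trans (le_of_eq (integral_congr_ae (Eventually.of_forall fun ω => mul_comm _ _)))
        ((integral_mul_exp_deviation_le hξ hHm hHc hb hs hsb hsq (by omega) (hu _ (by omega))
          (hmeas (N + 1) _ fun r hr => ?_) (fun ω => (Real.exp_pos _).le) (hbd _)).trans ih)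
      obtain ⟨h1, h2⟩ := Finset.mem_filter.1 hr
      have h3 := Finset.mem_Icc.1 h1
      have h4 : k ∣ N + 1 - r := (Nat.modEq_iff_dvd' (by omega)).1 (h2.trans hi.symm)
      have := Nat.le_of_dvd (by omega) h4
      omega
    · exact ih

/-- Exponential tail bound for a residue class. When `C = 0` the deviations vanish. -/
theorem measureReal_sum_deviation_gt_le (hξ : ∀ t, 1 ≤ t → Measurable (ξ t))
    (hHm : ∀ v, Measurable (H v)) (hHc : ∀ x, Continuous fun v => H v x)
    (hb : ∀ v x, |H v x| ≤ b) {C : ℝ} (hb0 : 0 ≤ b) (hbC : b ≤ C)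
    (hsq : ∀ v x, H v x ^ 2 ≤ C / 2 * ∫ y, H v y ∂π)
    (hu : ∀ r, 1 ≤ r → Measurable[pastSigma ξ r] (u r)) (i N : ℕ) (l : ℝ) :
    P.real {ω | C * l < ∑ r ∈ Finset.Icc 1 N with r % k = i, deviation P ξ π H b k u r ω}
      ≤ Real.exp (-l) := by
  rcases (hb0.trans hbC).eq_or_lt with hC | hC
  · have hbz : b = 0 := le_antisymm (hC ▸ hbC) hb0
    have hH : ∀ v x, H v x = 0 := fun v x => abs_nonpos_iff.1 (hbz ▸ hb v x)
    have hD : ∀ r ω, deviation P ξ π H b k u r ω = 0 := fun r ω => by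
      simp [deviation, hH, hbz]
    simpa [hD, ← hC] using (Real.exp_pos _).le
  · have hs : 0 ≤ C⁻¹ := (inv_pos.2 hC).le
    obtain ⟨h1, h2⟩ := integrable_and_integral_exp_sum_deviation_le_one (P := P) (π := π) (k := k)
      hξ hHm hHc hb hs (by rw [inv_mul_le_iff₀ hC]; linarith)
      (fun v x => by rw [inv_mul_le_iff₀ hC]; linarith [hsq v x]) hu i N
    have h3 := measure_ge_le_exp_mul_mgf (C * l) hs h1
    refine (measureReal_mono (fun ω (hω : C * l < _) => hω.le) (measure_ne_top _ _)).trans (h3.trans ?_)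
    have h4 : -C⁻¹ * (C * l) = -l := by field_simp
    rw [h4]
    exact mul_le_of_le_one_right (Real.exp_pos _).le h2

end Supermartingale

/-! ### Union bound over residue classes and block lengths -/

theorem exp_neg_two_mul_log_div {τ δ : ℝ} (hτ : 0 < τ) (hδ : 0 < δ) :
    Real.exp (-(2 * Real.log (τ / δ))) = (δ / τ) ^ 2 := by
  rw [show -(2 * Real.log (τ / δ)) = Real.log ((δ / τ) ^ 2) by
    rw [Real.log_pow, ← inv_div τ δ, Real.log_inv]; push_cast; ring]
  exact Real.exp_log (by positivity)

/-- The failure probabilities `(δ / τ)²` of the `τ` residue classes modulo `τ` sum, over `τ ≤ n`,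
to `δ²` times a harmonic number; this is what makes a bound uniform in `τ` affordable. -/
theorem sum_sum_exp_neg_two_mul_log_le {n : ℕ} (hn : 3 ≤ n) {δ : ℝ} (hδ : 0 < δ) (hδ1 : δ ≤ 1) :
    ∑ τ ∈ Finset.Icc 1 n, ∑ _i ∈ Finset.range τ, Real.exp (-(2 * Real.log ((τ : ℝ) / δ)))
      ≤ 4 * δ * Real.log n := by
  have hterm : ∀ τ ∈ Finset.Icc 1 n,
      ∑ _i ∈ Finset.range τ, Real.exp (-(2 * Real.log ((τ : ℝ) / δ))) = δ ^ 2 * (τ : ℝ)⁻¹ := by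
    intro τ hτ
    have h0 : (0 : ℝ) < τ := by exact_mod_cast (Finset.mem_Icc.1 hτ).1
    rw [Finset.sum_const, Finset.card_range, nsmul_eq_mul, exp_neg_two_mul_log_div h0 hδ]
    field_simp
  rw [Finset.sum_congr rfl hterm, ← Finset.mul_sum]
  have hharm : ∑ τ ∈ Finset.Icc 1 n, (τ : ℝ)⁻¹ ≤ 1 + Real.log n := by
    have := harmonic_le_one_add_log n
    rw [harmonic_eq_sum_Icc] at this
    push_cast at this
    exact this
  have hlog : 1 ≤ Real.log n := by
    rw [Real.le_log_iff_exp_le (by positivity)]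
    have h3 : (3 : ℝ) ≤ n := by exact_mod_cast hn
    linarith [Real.exp_one_lt_d9]
  calc _ ≤ δ ^ 2 * (1 + Real.log n) := by gcongr
    _ ≤ δ * (4 * Real.log n) := by
        rw [sq, mul_assoc]
        exact mul_le_mul_of_nonneg_left (by nlinarith) hδ.le
    _ = _ := by ring

/-- Some residue class, for some block length up to `n`, deviates with probability at most
`4 δ log n`. -/
theorem measureReal_exists_sum_deviation_gt_le
    {Ω Ξ V : Type*} [MeasurableSpace Ω] [MeasurableSpace Ξ]
    {P : Measure Ω} [IsProbabilityMeasure P] {ξ : ℕ → Ω → Ξ}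
    {π : Measure Ξ} [IsProbabilityMeasure π]
    [TopologicalSpace V] [TopologicalSpace.MetrizableSpace V] [SecondCountableTopology V]
    [MeasurableSpace V] [BorelSpace V]
    {H : V → Ξ → ℝ} {b : ℝ} {u : ℕ → Ω → V} (hξ : ∀ t, 1 ≤ t → Measurable (ξ t))
    (hHm : ∀ v, Measurable (H v)) (hHc : ∀ x, Continuous fun v => H v x)
    (hb : ∀ v x, |H v x| ≤ b) {C : ℝ} (hb0 : 0 ≤ b) (hbC : b ≤ C)
    (hsq : ∀ v x, H v x ^ 2 ≤ C / 2 * ∫ y, H v y ∂π)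
    (hu : ∀ r, 1 ≤ r → Measurable[pastSigma ξ r] (u r))
    {n : ℕ} (hn : 3 ≤ n) {δ : ℝ} (hδ : 0 < δ) (hδ1 : δ ≤ 1) :
    P.real {ω | ∃ τ ∈ Finset.Icc 1 n, ∃ i ∈ Finset.range τ,
        C * (2 * Real.log ((τ : ℝ) / δ)) <
          ∑ r ∈ Finset.Icc 1 (n - τ) with r % τ = i, deviation P ξ π H b τ u r ω}
      ≤ 4 * δ * Real.log n := by
  have hset : {ω | ∃ τ ∈ Finset.Icc 1 n, ∃ i ∈ Finset.range τ,
        C * (2 * Real.log ((τ : ℝ) / δ)) <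
          ∑ r ∈ Finset.Icc 1 (n - τ) with r % τ = i, deviation P ξ π H b τ u r ω}
      = ⋃ τ ∈ Finset.Icc 1 n, ⋃ i ∈ Finset.range τ, {ω | C * (2 * Real.log ((τ : ℝ) / δ)) <
          ∑ r ∈ Finset.Icc 1 (n - τ) with r % τ = i, deviation P ξ π H b τ u r ω} := by
    ext ω
    simp
  rw [hset]
  refine (measureReal_biUnion_finset_le _ _).trans (le_trans ?_
    (sum_sum_exp_neg_two_mul_log_le hn hδ hδ1))
  refine Finset.sum_le_sum fun τ _ => (measureReal_biUnion_finset_le _ _).trans ?_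
  exact Finset.sum_le_sum fun i _ =>
    measureReal_sum_deviation_gt_le hξ hHm hHc hb hb0 hbC hsq hu i (n - τ) _

theorem sum_Icc_le_of_forall_residue_sum_le {f : ℕ → ℝ} {τ N : ℕ} (hτ : 1 ≤ τ) {B : ℝ}
    (h : ∀ i ∈ Finset.range τ, ∑ r ∈ Finset.Icc 1 N with r % τ = i, f r ≤ B) :
    ∑ r ∈ Finset.Icc 1 N, f r ≤ τ * B := by
  rw [← Finset.sum_fiberwise_of_maps_to (t := Finset.range τ) (g := fun r => r % τ)
    fun r _ => Finset.mem_range.2 (Nat.mod_lt r hτ)]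
  simpa using Finset.sum_le_card_nsmul _ _ _ h

/-- The property may be checked almost everywhere off a possibly nonmeasurable exceptional set. -/
theorem holdsWithProbAtLeast_of_ae_imp {Ω : Type*} [MeasurableSpace Ω] {P : Measure Ω}
    [IsProbabilityMeasure P] {D : Set Ω} {ε : ℝ} (hD : P.real D ≤ ε) {Q : Ω → Prop}
    (h : ∀ᵐ ω ∂P, ω ∉ D → Q ω) : HoldsWithProbAtLeast P (1 - ε) Q := by
  refine ⟨(toMeasurable P {ω | ¬ Q ω})ᶜ, (measurableSet_toMeasurable _ _).compl,
    fun ω hω => ?_, ?_⟩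
  · by_contra hQ
    exact hω (subset_toMeasurable P _ hQ)
  · rw [probReal_compl_eq_one_sub (measurableSet_toMeasurable _ _)]
    have h1 : P {ω | ¬ Q ω} ≤ P D := measure_mono_ae <| by
      filter_upwards [h] with ω hω hQ
      by_contra hD
      exact hQ (hω hD)
    have h2 : P.real (toMeasurable P {ω | ¬ Q ω}) ≤ P.real D := by
      rw [Measure.real, measure_toMeasurable]
      exact ENNReal.toReal_mono (measure_ne_top _ _) h1
    linarith

/-! ### From regret to cumulative excess risk -/

/-- Deterministic part of the argument: `gap j` is the excess risk of the `j`-th iterate and `X j s`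
its excess loss on the sample `s`. Testing an iterate on a sample `p + 1` steps ahead instead of on
the next one costs `p` stability terms, and at most `p + 1` summands at the ends of the sums are
left unmatched. -/
theorem sum_gap_le_of_regret_of_deviation {gap κ : ℕ → ℝ} {X : ℕ → ℕ → ℝ} {N p : ℕ}
    {b c G T ρ : ℝ} (hG : 0 ≤ G) (hκ : ∀ j, 0 ≤ κ j) (hgap : ∀ j, gap j ≤ b)
    (hX : ∀ j s, -b ≤ X j s)
    (hstep : ∀ j, j + 1 < N + p + 1 → ∀ s, X j s ≤ X (j + 1) s + G * κ j)
    (hreg : ∑ j ∈ Finset.range (N + p + 1), X j (j + 1) ≤ ρ)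
    (hdev : ∑ r ∈ Finset.range N, (gap (r + 1) / 2 - X (r + 1) (r + 1 + (p + 1)) - c) ≤ T) :
    ∑ j ∈ Finset.range (N + p + 1), gap j
      ≤ 2 * ρ + 2 * p * G * ∑ j ∈ Finset.range (N + p + 1), κ j + 2 * N * c
        + 3 * (p + 1) * b + 2 * T := by
  have hmulti : ∀ m j, j + m < N + p + 1 → ∀ s,
      X j s ≤ X (j + m) s + G * ∑ i ∈ Finset.range m, κ (j + i) := by
    intro m
    induction m with
    | zero => intro j _ s; simp
    | succ m ih =>
      intro j hj s
      rw [Finset.sum_range_succ, mul_add]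
      have h1 := ih j (by omega) s
      have h2 := hstep (j + m) (by omega) s
      rw [add_assoc j m 1] at h2
      linarith
  have hgaps : ∑ j ∈ Finset.range (N + p + 1), gap j
      ≤ ∑ r ∈ Finset.range N, gap (r + 1) + (p + 1) * b := by
    rw [show N + p + 1 = N + 1 + p by ring, Finset.sum_range_add, Finset.sum_range_succ']
    have h1 : ∑ x ∈ Finset.range p, gap (N + 1 + x) ≤ p * b := by
      simpa using Finset.sum_le_card_nsmul (Finset.range p) (fun x => gap (N + 1 + x)) b
        fun x _ => hgap _
    linarith [hgap 0]
  have hXs : ∑ r ∈ Finset.range N, X (r + 1 + p) (r + 1 + (p + 1)) ≤ ρ + (p + 1) * b := by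
    rw [show N + p + 1 = p + 1 + N by ring, Finset.sum_range_add] at hreg
    have h1 : (p + 1) * -b ≤ ∑ x ∈ Finset.range (p + 1), X x (x + 1) := by
      simpa using Finset.card_nsmul_le_sum (Finset.range (p + 1)) (fun x => X x (x + 1)) (-b)
        fun x _ => hX _ _
    have h2 : ∑ r ∈ Finset.range N, X (r + 1 + p) (r + 1 + (p + 1))
        = ∑ x ∈ Finset.range N, X (p + 1 + x) (p + 1 + x + 1) :=
      Finset.sum_congr rfl fun r _ => by congr 1 <;> ring
    linarith
  have hκs : ∑ r ∈ Finset.range N, ∑ i ∈ Finset.range p, κ (r + 1 + i)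
      ≤ p * ∑ j ∈ Finset.range (N + p + 1), κ j := by
    rw [Finset.sum_comm]
    have h1 : ∀ i ∈ Finset.range p, ∑ r ∈ Finset.range N, κ (r + 1 + i)
        ≤ ∑ j ∈ Finset.range (N + p + 1), κ j := by
      intro i hi
      have hi' := Finset.mem_range.1 hi
      calc _ = ∑ j ∈ Finset.Ico (1 + i) (1 + i + N), κ j := by
            rw [Finset.sum_Ico_eq_sum_range, Nat.add_sub_cancel_left]
            exact Finset.sum_congr rfl fun r _ => by congr 1; ring
        _ ≤ _ := Finset.sum_le_sum_of_subset_of_nonneg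
            (fun j hj => Finset.mem_range.2 (by have := Finset.mem_Ico.1 hj; omega))
            fun j _ _ => hκ j
    simpa using Finset.sum_le_card_nsmul _ _ _ h1
  have hshift : ∑ r ∈ Finset.range N, X (r + 1) (r + 1 + (p + 1))
      ≤ ∑ r ∈ Finset.range N, X (r + 1 + p) (r + 1 + (p + 1))
        + G * ∑ r ∈ Finset.range N, ∑ i ∈ Finset.range p, κ (r + 1 + i) := by
    rw [Finset.mul_sum, ← Finset.sum_add_distrib]
    exact Finset.sum_le_sum fun r hr =>
      hmulti p (r + 1) (by have := Finset.mem_range.1 hr; omega) _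
  rw [Finset.sum_sub_distrib, Finset.sum_sub_distrib, ← Finset.sum_div, Finset.sum_const,
    Finset.card_range, nsmul_eq_mul] at hdev
  have := mul_le_mul_of_nonneg_left hκs hG
  linarith

/-! ### The excess loss -/

section Loss

variable {E Ξ : Type*} [NormedAddCommGroup E] [NormedSpace ℝ E] [MeasurableSpace Ξ]
  {W : Set E} {F : E → Ξ → ℝ} {μ π : Measure Ξ} {G R : ℝ}

theorem BoundedLoss.integrable [IsFiniteMeasure π] (h : BoundedLoss W F μ G R) (hπμ : π ≪ μ)
    (hF : ∀ v ∈ W, Measurable (F v)) {v : E} (hv : v ∈ W) : Integrable (F v) π := by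
  refine Integrable.of_bound (hF v hv).aestronglyMeasurable (G * R) ?_
  filter_upwards [hπμ.ae_le h.bounded] with x hx
  rw [Real.norm_of_nonneg (hx v hv).1]
  exact (hx v hv).2

theorem BoundedLoss.convexOn_risk [IsProbabilityMeasure π] (h : BoundedLoss W F μ G R)
    (hπμ : π ≪ μ) (hF : ∀ v ∈ W, Measurable (F v)) : ConvexOn ℝ W (risk F π) := by
  have hc : ∀ᵐ x ∂π, ConvexOn ℝ W fun w => F w x := hπμ.ae_le h.convex
  obtain ⟨x, hx⟩ := hc.exists
  refine ⟨hx.1, fun v hv v' hv' p q hp hq hpq => ?_⟩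
  have hi := (h.integrable hπμ hF hv).const_mul p
  have hi' := (h.integrable hπμ hF hv').const_mul q
  simp only [risk, smul_eq_mul]
  rw [← integral_const_mul, ← integral_const_mul, ← integral_add hi hi']
  refine integral_mono_ae (h.integrable hπμ hF (hx.1 hv hv' hp hq hpq)) (hi.add hi') ?_
  filter_upwards [hc] with y hy using hy.2 hv hv' hp hq hpq

/-- The excess loss `F(v; x) - F(w*; x)` has a version which is Lipschitz for every `x`: it is
replaced by `0` on a measurable null set of samples. -/
theorem BoundedLoss.exists_lipschitz_excess (h : BoundedLoss W F μ G R) (hG : 0 ≤ G)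
    (hF : ∀ v ∈ W, Measurable (F v)) {wstar : E} (hw : wstar ∈ W) :
    ∃ H : W → Ξ → ℝ, (∀ v, Measurable (H v)) ∧
      (∀ v v' x, |H v x - H v' x| ≤ G * ‖(v : E) - v'‖) ∧ (∀ x, H ⟨wstar, hw⟩ x = 0) ∧
      ∀ᵐ x ∂μ, ∀ v : W, H v x = F v x - F wstar x := by
  set N := toMeasurable μ {x | ¬ ∀ w ∈ W, ∀ v ∈ W, |F w x - F v x| ≤ G * ‖w - v‖} with hN
  have hNx : ∀ x, x ∉ N → ∀ w ∈ W, ∀ v ∈ W, |F w x - F v x| ≤ G * ‖w - v‖ := fun x hx => by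
    by_contra hcon
    exact hx (subset_toMeasurable μ _ hcon)
  have hN0 : ∀ᵐ x ∂μ, x ∉ N :=
    measure_eq_zero_iff_ae_notMem.1 ((measure_toMeasurable _).trans (ae_iff.1 h.lipschitz))
  refine ⟨fun v => Nᶜ.indicator fun x => F v x - F wstar x, fun v =>
    ((hF v v.2).sub (hF wstar hw)).indicator (measurableSet_toMeasurable _ _).compl,
    fun v v' x => ?_, fun x => by simp, ?_⟩
  · by_cases hx : x ∈ N
    · simpa [hx] using mul_nonneg hG (norm_nonneg _)
    · simpa [hx] using hNx x hx v v.2 v' v'.2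
  · filter_upwards [hN0] with x hx v
    simp [hx]

/-- Strong convexity at the minimizer, where `0` is a subgradient. -/
theorem IsStronglyConvexOver.mul_sq_le_sub {lam : ℝ} {f : E → ℝ}
    (hf : IsStronglyConvexOver W lam f) {wstar : E} (hw : wstar ∈ W) (hmin : IsMinOn f W wstar)
    {v : E} (hv : v ∈ W) : lam / 2 * ‖v - wstar‖ ^ 2 ≤ f v - f wstar := by
  have := hf wstar hw v hv 0 fun v' hv' => by simpa using hmin hv'
  rw [norm_sub_rev wstar v] at this
  simp only [zero_apply, add_zero] at this
  linarith

end Loss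

/-! ### The risk bound -/

/-- The assembled numerical bound, for a cumulative excess risk `S` and `L = log (τ / δ)`. -/
theorem div_le_of_sum_bound {S n τ ρ G R lam L φ K : ℝ} (hn : 0 < n) (hτ : 1 ≤ τ) (hG : 0 ≤ G)
    (hR : 0 ≤ R) (hlam : 0 < lam) (hL : 1 ≤ L)
    (hS : S ≤ 2 * ρ + 2 * (τ - 1) * G * K + 2 * n * (G * R * φ) + 3 * τ * (G * R)
      + 2 * (τ * ((4 * G ^ 2 / lam + G * R) * (2 * L)))) :
    n⁻¹ * S ≤ 2 / n * ρ + 2 * (τ - 1) * G / n * (K + 2 * R)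
      + 32 * G ^ 2 * τ / (lam * n) * L + 12 * τ * R * G / n * L + 2 * R * G * φ := by
  have h0 : 0 ≤ (τ - 1) * (G * R) := mul_nonneg (by linarith) (mul_nonneg hG hR)
  have h1 : 0 ≤ τ * (G * R) * (L - 1) :=
    mul_nonneg (mul_nonneg (by linarith) (mul_nonneg hG hR)) (by linarith)
  have h2 : 0 ≤ τ * (G * R) := mul_nonneg (by linarith) (mul_nonneg hG hR)
  have h3 : 0 ≤ τ * (G ^ 2 / lam) * L :=
    mul_nonneg (mul_nonneg (by linarith) (by positivity)) (by linarith)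
  rw [inv_mul_le_iff₀ hn]
  have h4 : n * (2 / n * ρ + 2 * (τ - 1) * G / n * (K + 2 * R)
      + 32 * G ^ 2 * τ / (lam * n) * L + 12 * τ * R * G / n * L + 2 * R * G * φ)
      = 2 * ρ + 2 * (τ - 1) * G * K + 4 * ((τ - 1) * (G * R)) + 32 * (τ * (G ^ 2 / lam) * L)
        + 12 * (τ * (G * R) * (L - 1)) + 12 * (τ * (G * R)) + 2 * n * (G * R * φ) := by
    field_simp
    ring
  have h5 : 2 * (τ * ((4 * G ^ 2 / lam + G * R) * (2 * L)))
      = 16 * (τ * (G ^ 2 / lam) * L) + 4 * (τ * (G * R) * (L - 1)) + 4 * (τ * (G * R)) := by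
    ring
  rw [h4]
  linarith

theorem sum_Icc_one_eq_sum_range {M : Type*} [AddCommMonoid M] (f : ℕ → M) (n : ℕ) :
    ∑ t ∈ Finset.Icc 1 n, f t = ∑ j ∈ Finset.range n, f (j + 1) := by
  induction n with
  | zero => simp
  | succ n ih => rw [Finset.sum_Icc_succ_top (by omega), Finset.sum_range_succ, ih]

theorem one_le_log_div {δ τ : ℝ} (hδ : 0 < δ) (hδe : δ < 1 / Real.exp 1) (hτ : 1 ≤ τ) :
    1 ≤ Real.log (τ / δ) := by
  rw [Real.le_log_iff_exp_le (by positivity), le_div_iff₀ hδ]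
  rw [lt_div_iff₀ (Real.exp_pos 1)] at hδe
  linarith

end OnlineMixing

theorem mainTheorem3
    {Ω Ξ E : Type*} [MeasurableSpace Ω] [MeasurableSpace Ξ]
    [NormedAddCommGroup E] [NormedSpace ℝ E] [MeasurableSpace E] [BorelSpace E]
    -- the sample process, the stationary distribution and the underlying measure
    (P : Measure Ω) [IsProbabilityMeasure P]
    (ξ : ℕ → Ω → Ξ) (hξ : ∀ t, 1 ≤ t → Measurable (ξ t))
    (π : Measure Ξ) [IsProbabilityMeasure π]
    (μ : Measure Ξ) (hπμ : π ≪ μ) (hξμ : ∀ t, 1 ≤ t → P.map (ξ t) ≪ μ)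
    -- the domain and the loss
    (W : Set E) (F : E → Ξ → ℝ) (hF : ∀ v ∈ W, Measurable (F v))
    (G R : ℝ) (hG : 0 ≤ G) (hbdd : OnlineMixing.BoundedLoss W F μ G R)
    (lam : ℝ) (hlam : 0 < lam)
    (hstrong : OnlineMixing.IsStronglyConvexOver W lam (OnlineMixing.risk F π))
    -- a minimizer of the expected loss over the domain
    (wstar : E) (hwstar : wstar ∈ W) (hmin : IsMinOn (OnlineMixing.risk F π) W wstar)
    -- the online algorithm: iterates, stability and regret
    (n : ℕ) (hn : 3 ≤ n)
    (w : ℕ → Ω → E)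
    (hw_meas : ∀ t, 1 ≤ t → t ≤ n → Measurable[OnlineMixing.pastSigma ξ (t - 1)] (w t))
    (hw_mem : ∀ t, 1 ≤ t → t ≤ n → ∀ ω, w t ω ∈ W)
    (κ : ℕ → ℝ) (hκ_nonneg : ∀ t, 1 ≤ t → 0 ≤ κ t) (hκ_anti : AntitoneOn κ (Set.Ici 1))
    (hstable : ∀ t, 1 ≤ t → t < n → ∀ᵐ ω ∂P, ‖w t ω - w (t + 1) ω‖ ≤ κ t)
    (Rn : Ω → ℝ)
    (hregret : ∀ v ∈ W, ∀ᵐ ω ∂P,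
      ∑ t ∈ Finset.Icc 1 n, (F (w t ω) (ξ t ω) - F v (ξ t ω)) ≤ Rn ω)
    (δ : ℝ) (hδ : 0 < δ) (hδe : δ < 1 / Real.exp 1) :
    OnlineMixing.HoldsWithProbAtLeast P (1 - 4 * δ * Real.log n) (fun ω =>
      ∀ τ : ℕ, 1 ≤ τ →
        OnlineMixing.risk F π (OnlineMixing.avgPredictor w n ω) - OnlineMixing.risk F π wstar
          ≤ 2 / n * Rn ω
            + 2 * ((τ : ℝ) - 1) * G / n * (∑ t ∈ Finset.Icc 1 n, κ t + 2 * R)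
            + 32 * G ^ 2 * τ / (lam * n) * Real.log (τ / δ)
            + 12 * τ * R * G / n * Real.log (τ / δ)
            + 2 * R * G * OnlineMixing.phiCoeff P ξ π τ) := by
  have hR : 0 ≤ R := by simpa using hbdd.radius wstar hwstar wstar hwstar
  have hGR : 0 ≤ G * R := mul_nonneg hG hR
  have hδ1 : δ ≤ 1 := hδe.le.trans <| by
    rw [div_le_one (Real.exp_pos 1)]
    exact Real.one_le_exp zero_le_one
  have hn0 : (0 : ℝ) < n := by exact_mod_cast (by omega : 0 < n)
  have : SecondCountableTopology W := hbdd.compact.isSeparable.secondCountableTopology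
  obtain ⟨H, hHm, hHlip, hHstar, hHF⟩ := hbdd.exists_lipschitz_excess hG hF hwstar
  have hHc : ∀ x, Continuous fun v => H v x := fun x =>
    (LipschitzWith.of_dist_le_mul (K := ⟨G, hG⟩) fun v v' => by
      rw [Real.dist_eq, Subtype.dist_eq, dist_eq_norm]; exact hHlip v v' x).continuous
  have hHnorm : ∀ v x, |H v x| ≤ G * ‖(v : E) - wstar‖ := fun v x => by
    simpa [hHstar] using hHlip v ⟨wstar, hwstar⟩ x
  have hHb : ∀ v x, |H v x| ≤ G * R := fun v x =>
    (hHnorm v x).trans (mul_le_mul_of_nonneg_left (hbdd.radius v v.2 wstar hwstar) hG)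
  have hrisk : ∀ v : W, ∫ x, H v x ∂π
      = OnlineMixing.risk F π v - OnlineMixing.risk F π wstar := fun v => by
    rw [OnlineMixing.risk, OnlineMixing.risk, ← integral_sub (hbdd.integrable hπμ hF v.2)
      (hbdd.integrable hπμ hF hwstar)]
    refine integral_congr_ae ?_
    filter_upwards [hπμ.ae_le hHF] with x hx using hx v
  set C := 4 * G ^ 2 / lam + G * R with hC
  have hsq : ∀ v x, H v x ^ 2 ≤ C / 2 * ∫ y, H v y ∂π := fun v x => by
    have h1 := hstrong.mul_sq_le_sub hwstar hmin v.2
    rw [← hrisk v] at h1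
    have hm0 : 0 ≤ ∫ y, H v y ∂π := le_trans (by positivity) h1
    have h2 : H v x ^ 2 ≤ G ^ 2 * ‖(v : E) - wstar‖ ^ 2 := by
      rw [← mul_pow, ← sq_abs]
      exact pow_le_pow_left₀ (abs_nonneg _) (hHnorm v x) 2
    have h3 : G ^ 2 * ‖(v : E) - wstar‖ ^ 2 ≤ 2 * G ^ 2 / lam * ∫ y, H v y ∂π := by
      calc G ^ 2 * ‖(v : E) - wstar‖ ^ 2
          = 2 * G ^ 2 / lam * (lam / 2 * ‖(v : E) - wstar‖ ^ 2) := by field_simp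
        _ ≤ _ := mul_le_mul_of_nonneg_left h1 (by positivity)
    have h4 : C / 2 * ∫ y, H v y ∂π
        = 2 * G ^ 2 / lam * ∫ y, H v y ∂π + G * R / 2 * ∫ y, H v y ∂π := by
      rw [hC]; ring
    have h5 : 0 ≤ G * R / 2 * ∫ y, H v y ∂π := by positivity
    linarith
  have hbC : G * R ≤ C := by rw [hC]; linarith [show 0 ≤ 4 * G ^ 2 / lam by positivity]
  -- the iterates as elements of `W`, numbered by the last sample they may depend on; beyond the
  -- horizon `n`, where nothing is known about `w`, they are set to `w*`
  let u : ℕ → Ω → W := fun r ω =>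
    if h : r + 1 ≤ n then ⟨w (r + 1) ω, hw_mem (r + 1) (by omega) h ω⟩ else ⟨wstar, hwstar⟩
  have hu_eq : ∀ r, r + 1 ≤ n → ∀ ω, (u r ω : E) = w (r + 1) ω := fun r h ω => by
    simp only [u, h, dif_pos]
  have hu : ∀ r, 1 ≤ r → Measurable[OnlineMixing.pastSigma ξ r] (u r) := by
    intro r _
    by_cases h : r + 1 ≤ n
    · simp only [u, h, dif_pos]
      exact (hw_meas (r + 1) (by omega) h).subtype_mk
    · simp only [u, h, dif_neg, not_false_eq_true]
      exact measurable_const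
  refine OnlineMixing.holdsWithProbAtLeast_of_ae_imp
    (OnlineMixing.measureReal_exists_sum_deviation_gt_le (P := P) (π := π)
      hξ hHm hHc hHb hGR hbC hsq hu hn hδ hδ1) ?_
  have hstable' : ∀ᵐ ω ∂P, ∀ t, 1 ≤ t → t < n → ‖w t ω - w (t + 1) ω‖ ≤ κ t :=
    ae_all_iff.2 fun t => ae_all_iff.2 fun h1 => ae_all_iff.2 fun h2 => hstable t h1 h2
  have hHF' : ∀ᵐ ω ∂P, ∀ t, 1 ≤ t → ∀ v : W, H v (ξ t ω) = F v (ξ t ω) - F wstar (ξ t ω) :=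
    ae_all_iff.2 fun t => ae_all_iff.2 fun h1 =>
      ae_of_ae_map (hξ t h1).aemeasurable ((hξμ t h1).ae_le hHF)
  filter_upwards [hstable', hHF', hregret wstar hwstar] with ω hst hHω hreg hD τ hτ
  have hτ' : (1 : ℝ) ≤ τ := by exact_mod_cast hτ
  have hL := OnlineMixing.one_le_log_div hδ hδe hτ'
  have hφ := OnlineMixing.phiCoeff_nonneg P ξ π τ
  set φ := OnlineMixing.phiCoeff P ξ π τ with hφdef
  set gap : ℕ → ℝ := fun j => ∫ x, H (u j ω) x ∂π with hgapdef
  have hgapb : ∀ j, gap j ≤ G * R := fun j =>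
    (abs_le.1 (OnlineMixing.abs_integral_le_of_forall_abs_le hHb (u j ω))).2
  have hregH : ∑ j ∈ Finset.range n, H (u j ω) (ξ (j + 1) ω) ≤ Rn ω := by
    rw [OnlineMixing.sum_Icc_one_eq_sum_range] at hreg
    refine le_trans (le_of_eq (Finset.sum_congr rfl fun j hj => ?_)) hreg
    rw [hHω _ (by omega), hu_eq j (Finset.mem_range.1 hj)]
  have hjensen : OnlineMixing.risk F π (OnlineMixing.avgPredictor w n ω)
      - OnlineMixing.risk F π wstar ≤ (n : ℝ)⁻¹ * ∑ j ∈ Finset.range n, gap j := by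
    have h1 := (hbdd.convexOn_risk hπμ hF).map_sum_le (t := Finset.range n)
      (w := fun _ => (n : ℝ)⁻¹) (p := fun j => (u j ω : E)) (fun _ _ => by positivity)
      (by simp [hn0.ne']) (fun j _ => (u j ω).2)
    have h2 : OnlineMixing.avgPredictor w n ω
        = ∑ j ∈ Finset.range n, (n : ℝ)⁻¹ • (u j ω : E) := by
      rw [OnlineMixing.avgPredictor, ← Finset.smul_sum, OnlineMixing.sum_Icc_one_eq_sum_range]
      exact congrArg _ (Finset.sum_congr rfl fun j hj => (hu_eq j (Finset.mem_range.1 hj) ω).symm)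
    rw [h2]
    simp only [hgapdef, hrisk, Finset.sum_sub_distrib, mul_sub, Finset.sum_const, nsmul_eq_mul,
      Finset.card_range, inv_mul_cancel_left₀ hn0.ne']
    rw [Finset.mul_sum]
    exact sub_le_sub_right h1 _
  refine hjensen.trans ?_
  refine OnlineMixing.div_le_of_sum_bound hn0 hτ' hG hR hlam hL ?_
  rw [OnlineMixing.sum_Icc_one_eq_sum_range]
  have hκ0 : 0 ≤ ∑ j ∈ Finset.range n, κ (j + 1) :=
    Finset.sum_nonneg fun j _ => hκ_nonneg _ (by omega)
  have hT0 : 0 ≤ (τ : ℝ) * (C * (2 * Real.log (τ / δ))) :=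
    mul_nonneg (by linarith) (mul_nonneg (hGR.trans hbC) (by linarith))
  rcases le_or_gt τ n with hτn | hτn
  · have hnN : n - τ + (τ - 1) + 1 = n := by omega
    have hp : τ - 1 + 1 = τ := by omega
    have key := OnlineMixing.sum_gap_le_of_regret_of_deviation (gap := gap)
      (κ := fun j => κ (j + 1)) (X := fun j s => H (u j ω) (ξ s ω)) (N := n - τ) (p := τ - 1)
      (b := G * R) (c := G * R * φ) (T := τ * (C * (2 * Real.log (τ / δ)))) (ρ := Rn ω) hG
      (fun j => hκ_nonneg _ (by omega)) hgapb (fun j s => (abs_le.1 (hHb _ _)).1)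
      (fun j hj s => by
        rw [hnN] at hj
        have h1 := (abs_le.1 (hHlip (u j ω) (u (j + 1) ω) (ξ s ω))).2
        rw [hu_eq j (by omega), hu_eq (j + 1) (by omega)] at h1
        have h2 := mul_le_mul_of_nonneg_left (hst (j + 1) (by omega) hj) hG
        linarith)
      (by rwa [hnN])
      (by
        rw [hp, ← OnlineMixing.sum_Icc_one_eq_sum_range
          fun r => gap r / 2 - H (u r ω) (ξ (r + τ) ω) - G * R * φ]
        refine OnlineMixing.sum_Icc_le_of_forall_residue_sum_le hτ fun i hi => ?_
        by_contra hcon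
        exact hD ⟨τ, Finset.mem_Icc.2 ⟨hτ, hτn⟩, i, hi, not_le.1 hcon⟩)
    rw [hnN, Nat.cast_sub hτn, Nat.cast_sub hτ, Nat.cast_one, sub_add_cancel] at key
    have h3 : 0 ≤ (τ : ℝ) * (G * R * φ) := mul_nonneg (by linarith) (mul_nonneg hGR hφ)
    linarith
  · -- with more lags than rounds, the trivial bounds on risk and regret suffice
    have hτn' : (n : ℝ) ≤ τ := by exact_mod_cast hτn.le
    have h1 : ∑ j ∈ Finset.range n, gap j ≤ n * (G * R) := by
      simpa using Finset.sum_le_card_nsmul (Finset.range n) gap (G * R) fun j _ => hgapb j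
    have h2 : n * -(G * R) ≤ ∑ j ∈ Finset.range n, H (u j ω) (ξ (j + 1) ω) := by
      simpa using Finset.card_nsmul_le_sum (Finset.range n) (fun j => H (u j ω) (ξ (j + 1) ω))
        (-(G * R)) fun j _ => (abs_le.1 (hHb _ _)).1
    have h3 : 0 ≤ 2 * ((τ : ℝ) - 1) * G * ∑ j ∈ Finset.range n, κ (j + 1) :=
      mul_nonneg (mul_nonneg (by linarith) hG) hκ0
    have h4 : 0 ≤ 2 * n * (G * R * φ) := by positivity
    have h5 : n * (G * R) ≤ τ * (G * R) := mul_le_mul_of_nonneg_right hτn' hGR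
    linarith
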